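/- Let $X=(X(t))_{t\in T}$, $T\subset\mathbb R^d$, be a real-valued, centred, square-integrable process, let $t_1,\dots,t_p\in T$, $x=(X(t_1),\dots,X(t_p))^\top$, $\Sigma=\mathbb E(xx^\top)$ and $\Phi=V(\mathrm{vec}(xx^\top))$ (the covariance matrix of $\mathrm{vec}(xx^\top)$). Let $\|A\|=\sqrt{\mathrm{Tr}(AA^\top)}$. Let $(g_\lambda)_{\lambda\in\Lambda}$ be a countable family of functions $T\to\mathbb R$ and $\mathcal M$ a finite collection of finite subsets (models) $m\subset\Lambda$. For $m\in\mathcal M$ put $G_m=(g_\lambda(t_j))_{1\le j\le p,\,\lambda\in m}$, $\Pi_m=G_m(G_m^\top G_m)^-G_m^\top$ (with $A^-$ a reflexive generalized inverse of $A$), $D_m=\mathrm{Tr}(\Pi_m\otimes\Pi_m)$, assumed positive, and $$\delta_m^2=\frac{\mathrm{Tr}((\Pi_m\otimes\Pi_m)\Phi)}{D_m},\quad \delta_m=\sqrt{\delta_m^2},\qquad C_{\inf}=\inf_{m\in\mathcal M}\mathrm{Tr}((\Pi_m\otimes\Pi_m)\Phi),\ \text{ assumed positive.}$$ Let $X_1,\dots,X_n$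 be independent copies of $X$, $x_i=(X_i(t_1),\dots,X_i(t_p))^\top$, $y_i=\mathrm{vec}(x_ix_i^\top)$, $S_{vec}=\frac1n\sum_{i=1}^n y_i$, and $$\widehat\Phi=\frac1n\sum_{i=1}^n\left(y_iy_i^\top-S_{vec}S_{vec}^\top\right),\qquad \widehat\delta_m^2=\frac{\mathrm{Tr}((\Pi_m\otimes\Pi_m)\widehat\Phi)}{D_m}.$$ **Proposition.** There are positive constants $C_1(\beta),C_2(\beta)$ depending only on $\beta$, and a threshold $n(\kappa,\beta,\alpha,C_{\inf},\Sigma)$ depending only on the displayed quantities, such that the following holds. Let $0<q\le 1$, $\beta>\max(2(1+2q),3+2q)$ with $\mathbb E\|xx^\top\|^\beta<\infty$, $\kappa\in\,]2(1+2q),\min(\beta,2\beta-4)[$, $\alpha\in\,]0,1[$, and put $\gamma=\kappa/4$. Then $\gamma\ge \frac{q}{1-2q/\kappa}$ and, for all $n\ge n(\kappa,\beta,\alpha,C_{\inf},\Sigma)$ and every $m\in\mathcal M$, $$\mathbb P\left(\widehat\delta_m^2\le(1-\alpha)\delta_m^2\right)\le\frac1{n^{\gamma}}\left(C_2(\beta)2^{\beta+1}+C_1(\beta)\frac1{\alpha^{\beta/2}}\right)\mathbb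 E\left[\|xx^\top\|^\beta\right]\delta_m^{-\beta}D_m^{-\beta/2}.$$ Consequently, for all such $n$, with $\Omega=\bigcap_{m\in\mathcal M}\{\widehat\delta_m^2\ge(1-\alpha)\delta_m^2\}$, $$\mathbb P(\Omega^c)\le\frac{\tilde C(\alpha)}{n^{\gamma}},\qquad \tilde C(\alpha)=\left(C_2(\beta)2^{\beta+1}+C_1(\beta)\frac1{\alpha^{\beta/2}}\right)\mathbb E\left[\|xx^\top\|^\beta\right]\sum_{m\in\mathcal M}\delta_m^{-\beta}D_m^{-\beta/2}.$$ -/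

import Mathlib

open MeasureTheory ProbabilityTheory
open scoped Kronecker Matrix

namespace CovSel

/-- Frobenius norm, `‖A‖² = Tr (A Aᵀ)`. -/
noncomputable def frob {k l : Type*} [Fintype k] [Fintype l] (A : Matrix k l ℝ) : ℝ :=
  Real.sqrt (A * Aᵀ).trace

/-- `B` is a reflexive generalized inverse of `A`. -/
def IsReflexiveInverse {k l : Type*} [Fintype k] [Fintype l]
    (A : Matrix k l ℝ) (B : Matrix l k ℝ) : Prop :=
  A * B * A = A ∧ B * A * B = B

theorem exists_isReflexiveInverse {k l : Type*} [Fintype k] [Fintype l]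
    (A : Matrix k l ℝ) : ∃ B : Matrix l k ℝ, IsReflexiveInverse A B := by
  classical
  let f := Matrix.toLin' A
  obtain ⟨s, hs⟩ := f.rangeRestrict.exists_rightInverse_of_surjective f.range_rangeRestrict
  obtain ⟨g, hg⟩ := LinearMap.exists_extend s
  have hfgf : f ∘ₗ g ∘ₗ f = f := by
    ext1 i
    ext1
    have h1 : g (f (LinearMap.single ℝ (fun _ => ℝ) i 1)) =
        s (f.rangeRestrict (LinearMap.single ℝ (fun _ => ℝ) i 1)) := by
      rw [← hg]; rfl
    have h2 := congrArg Subtype.val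
      (LinearMap.congr_fun hs (f.rangeRestrict (LinearMap.single ℝ (fun _ => ℝ) i 1)))
    simp only [LinearMap.comp_apply, h1]
    exact h2
  let C := LinearMap.toMatrix' g
  have hA : A * C * A = A := by
    have h := congrArg LinearMap.toMatrix' hfgf
    rw [LinearMap.toMatrix'_comp, LinearMap.toMatrix'_comp] at h
    simpa [f, C, Matrix.mul_assoc] using h
  refine ⟨C * A * C, ?_, ?_⟩
  · calc A * (C * A * C) * A = (A * C * A) * C * A := by simp only [Matrix.mul_assoc]
      _ = A := by rw [hA, hA]
  · calc C * A * C * A * (C * A * C) = C * (A * C * A) * C * A * C := by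
          simp only [Matrix.mul_assoc]
      _ = C * A * C * A * C := by rw [hA]
      _ = C * (A * C * A) * C := by simp only [Matrix.mul_assoc]
      _ = C * A * C := by rw [hA]

/-- A reflexive generalized inverse `A⁻` of `A`. -/
noncomputable def reflexiveInverse {k l : Type*} [Fintype k] [Fintype l]
    (A : Matrix k l ℝ) : Matrix l k ℝ :=
  (exists_isReflexiveInverse A).choose

theorem isReflexiveInverse_reflexiveInverse {k l : Type*} [Fintype k] [Fintype l]
    (A : Matrix k l ℝ) : IsReflexiveInverse A (reflexiveInverse A) :=
  (exists_isReflexiveInverse A).choose_spec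

section Models

variable {T Λ : Type*} {p : ℕ}

/-- The design matrix `G_m`, with entries `g_λ(t_j)`. -/
def design (g : Λ → T → ℝ) (t : Fin p → T) (m : Finset Λ) : Matrix (Fin p) m ℝ :=
  Matrix.of fun j l => g l (t j)

/-- `Π_m = G_m (G_mᵀ G_m)⁻ G_mᵀ`. -/
noncomputable def proj (g : Λ → T → ℝ) (t : Fin p → T) (m : Finset Λ) :
    Matrix (Fin p) (Fin p) ℝ :=
  design g t m * reflexiveInverse ((design g t m)ᵀ * design g t m) * (design g t m)ᵀ

/-- `D_m = Tr (Π_m ⊗ Π_m)`. -/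
noncomputable def dimM (g : Λ → T → ℝ) (t : Fin p → T) (m : Finset Λ) : ℝ :=
  (proj g t m ⊗ₖ proj g t m).trace

/-- `Tr ((Π_m ⊗ Π_m) Ψ)`. -/
noncomputable def projTrace (g : Λ → T → ℝ) (t : Fin p → T)
    (Ψ : Matrix (Fin p × Fin p) (Fin p × Fin p) ℝ) (m : Finset Λ) : ℝ :=
  ((proj g t m ⊗ₖ proj g t m) * Ψ).trace

end Models

section Population

variable {T Ω : Type*} [MeasurableSpace Ω] {p : ℕ}

/-- The vector `x = (X(t_1), …, X(t_p))` of values of a path at the observation points. -/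
def obs (t : Fin p → T) (path : T → ℝ) : Fin p → ℝ := fun j => path (t j)

/-- The matrix `x xᵀ`. -/
def obsSq (t : Fin p → T) (path : T → ℝ) : Matrix (Fin p) (Fin p) ℝ :=
  Matrix.vecMulVec (obs t path) (obs t path)

/-- The vector `y = vec (x xᵀ)`. -/
def obsVec (t : Fin p → T) (path : T → ℝ) : Fin p × Fin p → ℝ :=
  (obsSq t path).vec

/-- `Σ = E (x xᵀ)`. -/
noncomputable def sigmaMat (t : Fin p → T) (X : T → Ω → ℝ) (P : Measure Ω) :
    Matrix (Fin p) (Fin p) ℝ :=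
  Matrix.of fun j k => ∫ ω, obsSq t (fun s => X s ω) j k ∂P

/-- `Φ = V (vec (x xᵀ))`, the covariance matrix of `y`. -/
noncomputable def phiMat (t : Fin p → T) (X : T → Ω → ℝ) (P : Measure Ω) :
    Matrix (Fin p × Fin p) (Fin p × Fin p) ℝ :=
  Matrix.of fun a b =>
    covariance (fun ω => obsVec t (fun s => X s ω) a) (fun ω => obsVec t (fun s => X s ω) b) P

/-- `δ_m²`. -/
noncomputable def deltaSq {Λ : Type*} (g : Λ → T → ℝ) (t : Fin p → T) (X : T → Ω → ℝ)
    (P : Measure Ω) (m : Finset Λ) : ℝ :=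
  projTrace g t (phiMat t X P) m / dimM g t m

/-- `δ_m`. -/
noncomputable def delta {Λ : Type*} (g : Λ → T → ℝ) (t : Fin p → T) (X : T → Ω → ℝ)
    (P : Measure Ω) (m : Finset Λ) : ℝ :=
  Real.sqrt (deltaSq g t X P m)

/-- `C_inf = inf_{m ∈ M} Tr ((Π_m ⊗ Π_m) Φ)`. -/
noncomputable def cInf {Λ : Type*} (g : Λ → T → ℝ) (t : Fin p → T) (X : T → Ω → ℝ)
    (P : Measure Ω) (M : Finset (Finset Λ)) : ℝ :=
  ⨅ m : M, projTrace g t (phiMat t X P) m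

/-- `E ‖x xᵀ‖^β`. -/
noncomputable def normMoment (t : Fin p → T) (X : T → Ω → ℝ) (P : Measure Ω) (β : ℝ) : ℝ :=
  ∫ ω, frob (obsSq t (fun s => X s ω)) ^ β ∂P

end Population

section Empirical

variable {T : Type*} {p n : ℕ}

/-- `S_vec = n⁻¹ ∑ y_i`. -/
noncomputable def meanVec (t : Fin p → T) (paths : Fin n → T → ℝ) : Fin p × Fin p → ℝ :=
  (1 / (n : ℝ)) • ∑ i, obsVec t (paths i)

/-- `Φ̂ = n⁻¹ ∑ (y_i y_iᵀ - S_vec S_vecᵀ)`. -/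
noncomputable def phiHat (t : Fin p → T) (paths : Fin n → T → ℝ) :
    Matrix (Fin p × Fin p) (Fin p × Fin p) ℝ :=
  (1 / (n : ℝ)) • ∑ i, (Matrix.vecMulVec (obsVec t (paths i)) (obsVec t (paths i))
    - Matrix.vecMulVec (meanVec t paths) (meanVec t paths))

/-- `δ̂_m²`. -/
noncomputable def deltaHatSq {Λ : Type*} (g : Λ → T → ℝ) (t : Fin p → T)
    (paths : Fin n → T → ℝ) (m : Finset Λ) : ℝ :=
  projTrace g t (phiHat t paths) m / dimM g t m

end Empirical

end CovSel

open CovSel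

/-!
The Kronecker product `A = Π_m ⊗ Π_m` is an orthogonal projection, and `Tr (A Φ̂)` is `1 - 1/n`
times the U-statistic of order two with kernel `h(y, y') = (y - y')ᵀ A (y - y') / 2`. This kernel is
nonnegative, has mean `Tr (A Φ)`, and is at most `‖y‖² + ‖y'‖²`, so that its moment of order
`b = β / 2` is controlled by `E ‖x xᵀ‖ ^ β`. Hoeffding's averaging over permutations and Jensen's
inequality bound the Laplace transform of the U-statistic by that of a sum of `⌊n / 2⌋` independent
copies of `h(y, y')`. For a nonnegative variable a moment of order `r ∈ (1, 2]` suffices to control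
the Laplace transform on the negative half-line, since `e⁻ᵘ ≤ 1 - u + uʳ` for `u ≥ 0`. Chernoff's
bound with `r = min b 2` then gives a lower tail of order `n ^ (-min (b - 1) (b / 2))`, which is at
most `n ^ (-κ / 4)`; no Rosenthal inequality is needed.
-/

namespace CovSel

open scoped BigOperators

section UStatistic

variable {ι κ E : Type*} [Fintype ι]

theorem expect_perm_apply_apply [DecidableEq ι] {M : Type*} [AddCommMonoid M] [Module ℚ≥0 M]
    (F : ι → ι → M) {a b : ι} (hab : a ≠ b) :
    𝔼 σ : Equiv.Perm ι, F (σ a) (σ b) = 𝔼 q ∈ Finset.univ.offDiag, F q.1 q.2 := by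
  have indep_of_pair (q : ι × ι) (hq : q ∈ Finset.univ.offDiag) :
      𝔼 σ : Equiv.Perm ι, F (σ a) (σ b) = 𝔼 σ : Equiv.Perm ι, F (σ q.1) (σ q.2) := by
    obtain ⟨π, hπ₁, hπ₂⟩ := MulAction.is_two_pretransitive_iff.1
      (Equiv.Perm.isMultiplyPretransitive ι 2) hab (Finset.mem_offDiag.1 hq).2.2
    refine Fintype.expect_equiv (Equiv.mulRight π⁻¹) _ _ fun σ => ?_
    simp [← hπ₁, ← hπ₂]
  calc 𝔼 σ : Equiv.Perm ι, F (σ a) (σ b)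
      = 𝔼 q ∈ Finset.univ.offDiag, 𝔼 σ : Equiv.Perm ι, F (σ q.1) (σ q.2) := by
        rw [← Finset.expect_congr rfl indep_of_pair, Finset.expect_const ⟨(a, b), by simpa⟩]
    _ = 𝔼 σ : Equiv.Perm ι, 𝔼 q ∈ Finset.univ.offDiag, F (σ q.1) (σ q.2) := Finset.expect_comm ..
    _ = 𝔼 _σ : Equiv.Perm ι, 𝔼 q ∈ Finset.univ.offDiag, F q.1 q.2 :=
        Finset.expect_congr rfl fun σ _ =>
          Finset.expect_equiv (Equiv.prodCongr σ σ) (by simp) fun _ _ => rfl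
    _ = _ := Fintype.expect_const _

/-- The U-statistic of order two with kernel `h` evaluated at the sample `x`. The mean runs over
ordered pairs of distinct indices, so `h` need not be symmetric. -/
noncomputable def uStat (h : E × E → ℝ) (x : ι → E) : ℝ :=
  𝔼 q ∈ Finset.univ.offDiag, h (x q.1, x q.2)

theorem sum_sum_div_card_sq_eq_uStat {h : E × E → ℝ} (hdiag : ∀ y, h (y, y) = 0) (x : ι → E) :
    (∑ i, ∑ j, h (x i, x j)) / (Fintype.card ι : ℝ) ^ 2 =
      (1 - 1 / (Fintype.card ι : ℝ)) * uStat h x := by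
  classical
  have off_diag : ∑ i, ∑ j, h (x i, x j) = ∑ q ∈ Finset.univ.offDiag, h (x q.1, x q.2) := by
    rw [← Finset.sum_product', ← Finset.diag_union_offDiag,
      Finset.sum_union (Finset.disjoint_diag_offDiag _), Finset.sum_diag]
    simp [hdiag]
  rw [off_diag, ← Finset.card_mul_expect, Finset.offDiag_card, Finset.card_univ, ← uStat,
    Nat.cast_sub (Nat.le_mul_self _)]
  rcases eq_or_ne (Fintype.card ι : ℝ) 0 with hn | hn
  · have : IsEmpty ι := Fintype.card_eq_zero_iff.1 (by exact_mod_cast hn)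
    simp [uStat]
  · push_cast
    field_simp

theorem card_mul_uStat [DecidableEq ι] [Fintype κ] (e : κ ⊕ κ ↪ ι) (h : E × E → ℝ) (x : ι → E) :
    Fintype.card κ * uStat h x =
      𝔼 σ : Equiv.Perm ι, ∑ j, h (x (σ (e (.inl j))), x (σ (e (.inr j)))) := by
  rw [Finset.expect_sum_comm]
  have pair_mean (j : κ) :
      𝔼 σ : Equiv.Perm ι, h (x (σ (e (.inl j))), x (σ (e (.inr j)))) = uStat h x :=
    expect_perm_apply_apply (fun i i' => h (x i, x i')) (by simp)
  simp [pair_mean]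

theorem exp_mul_expect_le [Fintype κ] [Nonempty κ] (f : κ → ℝ) (t : ℝ) :
    Real.exp (t * 𝔼 i, f i) ≤ 𝔼 i, Real.exp (t * f i) := by
  have := convexOn_exp.map_centerMass_le (t := Finset.univ) (w := fun _ : κ => (1 : ℝ))
    (p := fun i => t * f i) (by simp) (by simp [Fintype.card_pos]) (by simp)
  simpa [Finset.centerMass, Fintype.expect_eq_sum_div_card, div_eq_inv_mul, Finset.mul_sum,
    mul_left_comm] using this

end UStatistic

section Independence

variable {Ω E ι κ : Type*} [MeasurableSpace Ω] [MeasurableSpace E] {Q : Measure Ω} {μ : Measure E}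
  [IsProbabilityMeasure μ]

theorem map_pairs_eq_pi [Fintype κ] {Y : ι → Ω → E} (hY : iIndepFun Y Q)
    (hm : ∀ i, AEMeasurable (Y i) Q) (hlaw : ∀ i, Q.map (Y i) = μ) (e : κ ⊕ κ ↪ ι) :
    Q.map (fun ω j => (Y (e (.inl j)) ω, Y (e (.inr j)) ω)) =
      Measure.pi fun _ : κ => μ.prod μ := by
  have hjoint := (hY.precomp e.injective).map_fun_eq_pi_map fun i => hm (e i)
  simp only [hlaw] at hjoint
  have hregroup := ((measurePreserving_arrowProdEquivProdArrow E E κ (fun _ => μ)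
    (fun _ => μ)).symm.comp (measurePreserving_sumPiEquivProdPi (fun _ : κ ⊕ κ => μ))).map_eq
  rw [← hregroup, ← hjoint, AEMeasurable.map_map_of_aemeasurable
    ((MeasurableEquiv.measurable _).comp (MeasurableEquiv.measurable _)).aemeasurable
    (aemeasurable_pi_lambda _ fun i => hm (e i))]
  rfl

theorem mgf_sum_pairs [Fintype κ] {Y : ι → Ω → E} (hY : iIndepFun Y Q)
    (hm : ∀ i, AEMeasurable (Y i) Q) (hlaw : ∀ i, Q.map (Y i) = μ) (e : κ ⊕ κ ↪ ι)
    {h : E × E → ℝ} (hh : Measurable h) (t : ℝ) :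
    mgf (fun ω => ∑ j, h (Y (e (.inl j)) ω, Y (e (.inr j)) ω)) Q t =
      mgf h (μ.prod μ) t ^ Fintype.card κ := by
  have hpairs : AEMeasurable (fun ω j => (Y (e (.inl j)) ω, Y (e (.inr j)) ω)) Q :=
    aemeasurable_pi_lambda _ fun j => (hm _).prodMk (hm _)
  rw [mgf, mgf, ← integral_fintype_prod_eq_pow fun z => Real.exp (t * h z),
    ← map_pairs_eq_pi hY hm hlaw e, integral_map hpairs
      (show Measurable _ by fun_prop).aestronglyMeasurable]
  simp only [Finset.mul_sum, Real.exp_sum]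

theorem integrable_exp_mul_sum_pairs [Fintype κ] {Y : ι → Ω → E} (hY : iIndepFun Y Q)
    (hm : ∀ i, AEMeasurable (Y i) Q) (hlaw : ∀ i, Q.map (Y i) = μ) (e : κ ⊕ κ ↪ ι)
    {h : E × E → ℝ} {t : ℝ} (ht : Integrable (fun z => Real.exp (t * h z)) (μ.prod μ)) :
    Integrable (fun ω => Real.exp (t * ∑ j, h (Y (e (.inl j)) ω, Y (e (.inr j)) ω))) Q := by
  have hpairs : AEMeasurable (fun ω j => (Y (e (.inl j)) ω, Y (e (.inr j)) ω)) Q :=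
    aemeasurable_pi_lambda _ fun j => (hm _).prodMk (hm _)
  have hprod := Integrable.fintype_prod fun _ : κ => ht
  rw [← map_pairs_eq_pi hY hm hlaw e] at hprod
  simpa only [Finset.mul_sum, Real.exp_sum, Function.comp_def] using hprod.comp_aemeasurable hpairs

theorem mgf_uStat_le [Fintype ι] [Fintype κ] {Y : ι → Ω → E} (hY : iIndepFun Y Q)
    (hm : ∀ i, AEMeasurable (Y i) Q) (hlaw : ∀ i, Q.map (Y i) = μ) (e : κ ⊕ κ ↪ ι)
    {h : E × E → ℝ} (hh : Measurable h) {t : ℝ}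
    (ht : Integrable (fun z => Real.exp (t * h z)) (μ.prod μ)) :
    mgf (fun ω => uStat h fun i => Y i ω) Q (Fintype.card κ * t) ≤
      mgf h (μ.prod μ) t ^ Fintype.card κ := by
  classical
  have hint (σ : Equiv.Perm ι) := integrable_exp_mul_sum_pairs hY hm hlaw
    (e.trans σ.toEmbedding) ht
  have hmgf (σ : Equiv.Perm ι) := mgf_sum_pairs hY hm hlaw (e.trans σ.toEmbedding) hh t
  simp only [mgf, Function.Embedding.trans_apply, Equiv.coe_toEmbedding] at hint hmgf ⊢
  calc _ ≤ ∫ ω, 𝔼 σ : Equiv.Perm ι, Real.exp (t *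
        ∑ j, h (Y (σ (e (.inl j))) ω, Y (σ (e (.inr j))) ω)) ∂Q := by
        refine integral_mono_of_nonneg (ae_of_all _ fun ω => (Real.exp_pos _).le) ?_
          (ae_of_all _ fun ω => ?_)
        · simp only [Fintype.expect_eq_sum_div_card]
          exact (integrable_finsetSum _ fun σ _ => hint σ).div_const _
        · beta_reduce
          rw [mul_comm (Fintype.card κ : ℝ), mul_assoc, card_mul_uStat e]
          exact exp_mul_expect_le ..
    _ = _ := by
        simp only [Fintype.expect_eq_sum_div_card, integral_div]
        rw [integral_finsetSum _ fun σ _ => hint σ]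
        simp [hmgf, Fintype.card_ne_zero]

end Independence

section RealInequalities

theorem exp_neg_le_one_sub_add_rpow {u r : ℝ} (hu : 0 ≤ u) (hr : 1 ≤ r) (hr₂ : r ≤ 2) :
    Real.exp (-u) ≤ 1 - u + u ^ r := by
  rcases le_total u 1 with hu1 | hu1
  · have hexp : Real.exp (-u) - 1 - -u ≤ (-u) ^ 2 :=
      (abs_le.1 (Real.abs_exp_sub_one_sub_id_le (by rwa [abs_neg, abs_of_nonneg hu]))).2
    have hpow : u ^ (2 : ℝ) ≤ u ^ r :=
      Real.rpow_le_rpow_of_exponent_ge' hu hu1 (by linarith) hr₂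
    rw [Real.rpow_two] at hpow
    linarith [neg_sq u]
  · have hexp : Real.exp (-u) ≤ 1 := Real.exp_le_one_iff.2 (neg_nonpos.2 hu)
    have hpow : u ≤ u ^ r := Real.self_le_rpow_of_one_le hu1 hr
    linarith

theorem exp_neg_le_rpow_mul_rpow_neg {v s : ℝ} (hv : 0 < v) (hs : 0 < s) :
    Real.exp (-v) ≤ s ^ s * v ^ (-s) := by
  have hpow : (v / s) ^ s ≤ Real.exp v := by
    calc (v / s) ^ s ≤ Real.exp (v / s) ^ s := by
          gcongr
          linarith [Real.add_one_le_exp (v / s)]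
      _ = Real.exp v := by rw [← Real.exp_mul, div_mul_cancel₀ _ hs.ne']
  calc Real.exp (-v) ≤ ((v / s) ^ s)⁻¹ := by
        rw [Real.exp_neg]
        exact inv_anti₀ (by positivity) hpow
    _ = s ^ s * v ^ (-s) := by
        rw [Real.div_rpow hv.le hs.le, inv_div, Real.rpow_neg hv.le, div_eq_mul_inv]

/-- The parameter `l` balances the two parts of a Chernoff exponent `-2lθ + lʳw`. -/
theorem exists_pos_rpow_mul_eq_mul {θ w r : ℝ} (hθ : 0 < θ) (hw : 0 < w) (hr : 1 < r) :
    ∃ l, 0 < l ∧ l ^ r * w = l * θ ∧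
      ∀ b, (l * θ) ^ (-(b - b / r)) = θ ^ (-b) * w ^ (b / r) := by
  have hr1 : r - 1 ≠ 0 := by linarith
  have hr0 : r ≠ 0 := by linarith
  refine ⟨(θ / w) ^ (1 / (r - 1)), by positivity, ?_, fun b => ?_⟩ <;>
    refine Real.log_injOn_pos (Set.mem_Ioi.2 (by positivity)) (Set.mem_Ioi.2 (by positivity)) ?_
  · rw [Real.log_mul (by positivity) hw.ne', Real.log_mul (by positivity) hθ.ne',
      Real.log_rpow (by positivity), Real.log_rpow (by positivity), Real.log_div hθ.ne' hw.ne']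
    field_simp
    ring
  · rw [Real.log_rpow (by positivity), Real.log_mul (by positivity) hθ.ne',
      Real.log_rpow (by positivity), Real.log_div hθ.ne' hw.ne', Real.log_mul (by positivity)
      (by positivity), Real.log_rpow hθ, Real.log_rpow hw]
    field_simp
    ring

theorem half_rpow_neg_le {n : ℕ} (hn : 2 ≤ n) {s : ℝ} (hs : 0 ≤ s) :
    ((n / 2 : ℕ) : ℝ) ^ (-s) ≤ 4 ^ s * (n : ℝ) ^ (-s) := by
  have hquarter : (n : ℝ) / 4 ≤ (n / 2 : ℕ) := by
    have : n ≤ 4 * (n / 2) := by omega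
    have : (n : ℝ) ≤ 4 * (n / 2 : ℕ) := by exact_mod_cast this
    linarith
  have hn0 : (0 : ℝ) < n := by positivity
  calc ((n / 2 : ℕ) : ℝ) ^ (-s) ≤ ((n : ℝ) / 4) ^ (-s) :=
        Real.rpow_le_rpow_of_nonpos (by positivity) hquarter (neg_nonpos.2 hs)
    _ = 4 ^ s * (n : ℝ) ^ (-s) := by
        rw [Real.div_rpow hn0.le (by norm_num), Real.rpow_neg (by norm_num : (0 : ℝ) ≤ 4),
          div_inv_eq_mul, mul_comm]

/-- The polynomial order of the lower tail of a nonnegative U-statistic of order two whose kernel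
has a moment of order `b`. -/
noncomputable def tailOrder (b : ℝ) : ℝ := min (b - 1) (b / 2)

theorem tailOrder_pos {b : ℝ} (hb : 1 < b) : 0 < tailOrder b :=
  lt_min (by linarith) (by linarith)

theorem sub_div_min_two {b : ℝ} (hb : 0 < b) : b - b / min b 2 = tailOrder b := by
  rcases le_total b 2 with h | h
  · rw [tailOrder, min_eq_left h, min_eq_left (by linarith), div_self hb.ne']
  · rw [tailOrder, min_eq_right h, min_eq_right (by linarith)]
    ring

end RealInequalities

section Moments

variable {α : Type*} [MeasurableSpace α] {ν : Measure α} {f : α → ℝ}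

theorem integrable_rpow_of_le [IsFiniteMeasure ν] (hf : AEStronglyMeasurable f ν) (h0 : 0 ≤ f)
    {r b : ℝ} (hr : 0 ≤ r) (hrb : r ≤ b) (hb : Integrable (fun x => f x ^ b) ν) :
    Integrable (fun x => f x ^ r) ν := by
  have hnorm (x : α) : ‖f x‖ = f x := Real.norm_of_nonneg (h0 x)
  simpa only [hnorm] using integrable_norm_rpow_of_le hf hr (hr.trans hrb) hrb
    (by simpa only [hnorm] using hb)

theorem integrable_exp_neg_mul [IsFiniteMeasure ν] (hf : AEStronglyMeasurable f ν) (h0 : 0 ≤ f)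
    {l : ℝ} (hl : 0 ≤ l) :
    Integrable (fun x => Real.exp (-l * f x)) ν := by
  refine Integrable.of_bound (C := 1) (by fun_prop) (ae_of_all _ fun x => ?_)
  rw [Real.norm_of_nonneg (Real.exp_pos _).le, Real.exp_le_one_iff, neg_mul, neg_nonpos]
  exact mul_nonneg hl (h0 x)

variable [IsProbabilityMeasure ν]

theorem rpow_integral_rpow_le (hf : AEStronglyMeasurable f ν) (h0 : 0 ≤ f) {r b : ℝ} (hr : 0 < r)
    (hrb : r ≤ b) (hb : Integrable (fun x => f x ^ b) ν) :
    (∫ x, f x ^ r ∂ν) ^ (b / r) ≤ ∫ x, f x ^ b ∂ν := by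
  have hpow (x : α) : (f x ^ r) ^ (b / r) = f x ^ b := by
    rw [← Real.rpow_mul (h0 x), mul_div_cancel₀ _ hr.ne']
  have jensen := (convexOn_rpow ((one_le_div hr).2 hrb)).map_integral_le
    (μ := ν) (f := fun x => f x ^ r) (continuousOn_id.rpow_const fun _ _ =>
      Or.inr (div_nonneg (hr.le.trans hrb) hr.le))
    isClosed_Ici (ae_of_all _ fun x => Real.rpow_nonneg (h0 x) r)
    (integrable_rpow_of_le hf h0 hr.le hrb hb) (by simpa only [Function.comp_def, hpow] using hb)
  simpa only [hpow] using jensen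

theorem mgf_neg_le (hf : AEStronglyMeasurable f ν) (h0 : 0 ≤ f) {r : ℝ} (hr : 1 ≤ r) (hr₂ : r ≤ 2)
    (hfr : Integrable (fun x => f x ^ r) ν) {l : ℝ} (hl : 0 ≤ l) :
    mgf f ν (-l) ≤ Real.exp (-(l * ∫ x, f x ∂ν) + l ^ r * ∫ x, f x ^ r ∂ν) := by
  have hf1 : Integrable f ν := by
    simpa using integrable_rpow_of_le hf h0 zero_le_one hr hfr
  have hlin : Integrable (fun x => 1 - l * f x) ν := (integrable_const _).sub (hf1.const_mul _)
  calc mgf f ν (-l) ≤ ∫ x, (1 - l * f x) + l ^ r * f x ^ r ∂ν := by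
        refine integral_mono (integrable_exp_neg_mul hf h0 hl) (hlin.add (hfr.const_mul _))
          fun x => ?_
        have := exp_neg_le_one_sub_add_rpow (mul_nonneg hl (h0 x)) hr hr₂
        rwa [Real.mul_rpow hl (h0 x), ← neg_mul] at this
    _ = (-(l * ∫ x, f x ∂ν) + l ^ r * ∫ x, f x ^ r ∂ν) + 1 := by
        rw [integral_add hlin (hfr.const_mul _), integral_sub (integrable_const _)
          (hf1.const_mul _), integral_const_mul, integral_const_mul]
        simp
        ring
    _ ≤ _ := Real.add_one_le_exp _

end Moments

section TailBound

variable {Ω E ι : Type*} [MeasurableSpace Ω] [MeasurableSpace E] {Q : Measure Ω}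
  [IsProbabilityMeasure Q] {μ : Measure E} [IsProbabilityMeasure μ] [Fintype ι]
  {Y : ι → Ω → E} {h : E × E → ℝ}

theorem measureReal_uStat_le_exp {κ : Type*} [Fintype κ] (hY : iIndepFun Y Q)
    (hm : ∀ i, AEMeasurable (Y i) Q) (hlaw : ∀ i, Q.map (Y i) = μ) (e : κ ⊕ κ ↪ ι)
    (hh : Measurable h) (h0 : 0 ≤ h) {r : ℝ} (hr : 1 ≤ r) (hr₂ : r ≤ 2)
    (hhr : Integrable (fun z => h z ^ r) (μ.prod μ)) {l : ℝ} (hl : 0 ≤ l) (x : ℝ) :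
    Q.real {ω | uStat h (fun i => Y i ω) ≤ ∫ z, h z ∂μ.prod μ - x} ≤
      Real.exp (-(Fintype.card κ * (l * x - l ^ r * ∫ z, h z ^ r ∂μ.prod μ))) := by
  have hh' : AEStronglyMeasurable h (μ.prod μ) := hh.aestronglyMeasurable
  have hU0 : 0 ≤ fun ω => uStat h fun i => Y i ω := fun ω => Finset.expect_nonneg fun _ _ => h0 _
  have hUm : AEMeasurable (fun ω => uStat h fun i => Y i ω) Q := by
    simp only [uStat, Finset.expect_eq_sum_div_card]
    exact (Finset.aemeasurable_fun_sum _ fun q _ =>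
      hh.comp_aemeasurable ((hm q.1).prodMk (hm q.2))).div_const _
  have chernoff := measure_le_le_exp_mul_mgf (μ := Q) (t := -(Fintype.card κ * l))
    (∫ z, h z ∂μ.prod μ - x) (by simp only [neg_nonpos]; positivity)
    (integrable_exp_neg_mul hUm.aestronglyMeasurable hU0 (by positivity))
  have hmgf : mgf (fun ω => uStat h fun i => Y i ω) Q (-(Fintype.card κ * l)) ≤
      Real.exp (-(l * ∫ z, h z ∂μ.prod μ) + l ^ r * ∫ z, h z ^ r ∂μ.prod μ) ^ Fintype.card κ := by
    rw [← mul_neg]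
    exact (mgf_uStat_le hY hm hlaw e hh (integrable_exp_neg_mul hh' h0 hl)).trans
      (pow_le_pow_left₀ mgf_nonneg (mgf_neg_le hh' h0 hr hr₂ hhr hl) _)
  refine (chernoff.trans (mul_le_mul_of_nonneg_left hmgf (Real.exp_pos _).le)).trans_eq ?_
  rw [← Real.exp_nat_mul, ← Real.exp_add]
  congr 1
  ring

theorem measureReal_uStat_le_rpow (hY : iIndepFun Y Q) (hm : ∀ i, AEMeasurable (Y i) Q)
    (hlaw : ∀ i, Q.map (Y i) = μ) (hι : 2 ≤ Fintype.card ι) (hh : Measurable h) (h0 : 0 ≤ h)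
    {b : ℝ} (hb : 1 < b) (hhb : Integrable (fun z => h z ^ b) (μ.prod μ))
    (hpos : 0 < ∫ z, h z ∂μ.prod μ) {x : ℝ} (hx : 0 < x) :
    Q.real {ω | uStat h (fun i => Y i ω) ≤ ∫ z, h z ∂μ.prod μ - x} ≤
      (4 * tailOrder b) ^ tailOrder b * (Fintype.card ι : ℝ) ^ (-tailOrder b) *
        ((x / 2) ^ (-b) * ∫ z, h z ^ b ∂μ.prod μ) := by
  have hh' : AEStronglyMeasurable h (μ.prod μ) := hh.aestronglyMeasurable
  have hs := tailOrder_pos hb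
  set s := tailOrder b
  set r := min b 2
  set k := Fintype.card ι / 2
  have hr : 1 < r := lt_min hb one_lt_two
  have hrb : r ≤ b := min_le_left _ _
  have hhr := integrable_rpow_of_le hh' h0 (by linarith) hrb hhb
  have hw : 0 < ∫ z, h z ^ r ∂μ.prod μ :=
    (Real.rpow_pos_of_pos hpos r).trans_le
      (by simpa using rpow_integral_rpow_le hh' h0 one_pos hr.le hhr)
  obtain ⟨l, hl, hbalance, hvalue⟩ := exists_pos_rpow_mul_eq_mul (half_pos hx) hw hr
  obtain ⟨e⟩ : Nonempty (Fin k ⊕ Fin k ↪ ι) :=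
    Function.Embedding.nonempty_of_card_le (by simp [k]; omega)
  have hk : (0 : ℝ) < k := by exact_mod_cast (by omega : 0 < Fintype.card ι / 2)
  calc Q.real {ω | uStat h (fun i => Y i ω) ≤ ∫ z, h z ∂μ.prod μ - x}
      ≤ Real.exp (-(k * (l * x - l ^ r * ∫ z, h z ^ r ∂μ.prod μ))) := by
        simpa using
          measureReal_uStat_le_exp hY hm hlaw e hh h0 hr.le (min_le_right _ _) hhr hl.le x
    _ = Real.exp (-(k * (l * (x / 2)))) := by
        rw [hbalance]
        ring_nf
    _ ≤ s ^ s * (k * (l * (x / 2))) ^ (-s) := exp_neg_le_rpow_mul_rpow_neg (by positivity) hs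
    _ = s ^ s * (k : ℝ) ^ (-s) * ((x / 2) ^ (-b) * (∫ z, h z ^ r ∂μ.prod μ) ^ (b / r)) := by
        rw [Real.mul_rpow hk.le (by positivity), ← hvalue, sub_div_min_two (by linarith),
          mul_assoc]
    _ ≤ s ^ s * (4 ^ s * (Fintype.card ι : ℝ) ^ (-s)) *
          ((x / 2) ^ (-b) * ∫ z, h z ^ b ∂μ.prod μ) := by
        gcongr
        · exact half_rpow_neg_le hι hs.le
        · exact rpow_integral_rpow_le hh' h0 (by linarith) hrb hhb
    _ = _ := by
        rw [Real.mul_rpow (by norm_num) hs.le]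
        ring

end TailBound

section Projection

variable {k l R : Type*} [Fintype k] [Fintype l]

theorem mul_mul_conjTranspose_mul_self [Ring R] [PartialOrder R] [StarRing R] [StarOrderedRing R]
    [NoZeroDivisors R] {G : Matrix k l R} {B : Matrix l l R} (hB : Gᴴ * G * B * (Gᴴ * G) = Gᴴ * G) :
    G * B * (Gᴴ * G) = G := by
  classical
  have hzero : Gᴴ * G * (B * (Gᴴ * G) - 1) = 0 := by
    rw [Matrix.mul_sub, Matrix.mul_one, ← Matrix.mul_assoc, hB, sub_self]
  rw [Matrix.conjTranspose_mul_self_mul_eq_zero, Matrix.mul_sub, Matrix.mul_one, sub_eq_zero,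
    ← Matrix.mul_assoc] at hzero
  exact hzero

theorem isStarProjection_mul_mul_conjTranspose [Ring R] [PartialOrder R] [StarRing R]
    [StarOrderedRing R] [NoZeroDivisors R] {G : Matrix k l R} {B : Matrix l l R}
    (hB : Gᴴ * G * B * (Gᴴ * G) = Gᴴ * G) : IsStarProjection (G * B * Gᴴ) := by
  have hBG := mul_mul_conjTranspose_mul_self hB
  have hBstar : Gᴴ * G * Bᴴ * (Gᴴ * G) = Gᴴ * G := by
    simpa only [Matrix.conjTranspose_mul, Matrix.conjTranspose_conjTranspose, Matrix.mul_assoc]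
      using congrArg Matrix.conjTranspose hB
  have hGB : Gᴴ * G * B * Gᴴ = Gᴴ := by
    simpa only [Matrix.conjTranspose_mul, Matrix.conjTranspose_conjTranspose, Matrix.mul_assoc]
      using congrArg Matrix.conjTranspose (mul_mul_conjTranspose_mul_self hBstar)
  have hstar_mul : (G * B * Gᴴ)ᴴ * (G * B * Gᴴ) = (G * B * Gᴴ)ᴴ := by
    calc (G * B * Gᴴ)ᴴ * (G * B * Gᴴ) = G * Bᴴ * (Gᴴ * G * B * Gᴴ) := by
          simp only [Matrix.conjTranspose_mul, Matrix.conjTranspose_conjTranspose,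
            Matrix.mul_assoc]
      _ = (G * B * Gᴴ)ᴴ := by
          rw [hGB, Matrix.conjTranspose_mul, Matrix.conjTranspose_mul,
            Matrix.conjTranspose_conjTranspose, Matrix.mul_assoc]
  refine ⟨?_, ?_⟩
  · calc G * B * Gᴴ * (G * B * Gᴴ) = G * B * (Gᴴ * G) * B * Gᴴ := by
          simp only [Matrix.mul_assoc]
      _ = G * B * Gᴴ := by rw [hBG]
  · rw [IsSelfAdjoint, Matrix.star_eq_conjTranspose, ← hstar_mul]
    simpa only [Matrix.conjTranspose_mul, Matrix.conjTranspose_conjTranspose] using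
      (congrArg Matrix.conjTranspose hstar_mul)

theorem isStarProjection_kronecker [CommSemiring R] [StarRing R] {A : Matrix k k R}
    {B : Matrix l l R} (hA : IsStarProjection A) (hB : IsStarProjection B) :
    IsStarProjection (A ⊗ₖ B) where
  isIdempotentElem := by
    rw [IsIdempotentElem, ← Matrix.mul_kronecker_mul, hA.isIdempotentElem.eq,
      hB.isIdempotentElem.eq]
  isSelfAdjoint := by
    rw [IsSelfAdjoint, Matrix.star_eq_conjTranspose, Matrix.conjTranspose_kronecker,
      ← Matrix.star_eq_conjTranspose, ← Matrix.star_eq_conjTranspose, hA.isSelfAdjoint.star_eq,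
      hB.isSelfAdjoint.star_eq]

theorem posSemidef_of_isStarProjection [Ring R] [PartialOrder R] [StarRing R] [StarOrderedRing R]
    {A : Matrix k k R} (hA : IsStarProjection A) : A.PosSemidef := by
  have hsq : Aᴴ * A = A := by
    rw [← Matrix.star_eq_conjTranspose, hA.isSelfAdjoint.star_eq, hA.isIdempotentElem.eq]
  exact hsq ▸ Matrix.posSemidef_conjTranspose_mul_self A

theorem isStarProjection_proj {T Λ : Type*} {p : ℕ} (g : Λ → T → ℝ) (t : Fin p → T)
    (m : Finset Λ) : IsStarProjection (proj g t m) := by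
  rw [proj, ← Matrix.conjTranspose_eq_transpose_of_trivial]
  exact isStarProjection_mul_mul_conjTranspose (isReflexiveInverse_reflexiveInverse _).1

end Projection

section PairForm

variable {ι : Type*} [Fintype ι] {A : Matrix ι ι ℝ}

theorem dotProduct_self_nonneg (y : ι → ℝ) : 0 ≤ y ⬝ᵥ y :=
  Finset.sum_nonneg fun _ _ => mul_self_nonneg _

/-- Half the quadratic form of the difference of two vectors. As a kernel on independent copies of
a random vector, it has mean `Tr (A Φ)` where `Φ` is the covariance matrix. -/
noncomputable def pairForm (A : Matrix ι ι ℝ) (z : (ι → ℝ) × (ι → ℝ)) : ℝ :=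
  ((z.1 - z.2) ⬝ᵥ A *ᵥ (z.1 - z.2)) / 2

theorem measurable_pairForm (A : Matrix ι ι ℝ) : Measurable (pairForm A) := by
  unfold pairForm dotProduct Matrix.mulVec dotProduct
  fun_prop

theorem pairForm_self (A : Matrix ι ι ℝ) (y : ι → ℝ) : pairForm A (y, y) = 0 := by
  simp [pairForm]

theorem pairForm_nonneg (hA : A.PosSemidef) : 0 ≤ pairForm A := fun z =>
  div_nonneg (by simpa using hA.dotProduct_mulVec_nonneg (z.1 - z.2)) zero_le_two

theorem pairForm_le [DecidableEq ι] (hA : (1 - A).PosSemidef) (z : (ι → ℝ) × (ι → ℝ)) :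
    pairForm A z ≤ z.1 ⬝ᵥ z.1 + z.2 ⬝ᵥ z.2 := by
  have hcontract : (z.1 - z.2) ⬝ᵥ A *ᵥ (z.1 - z.2) ≤ (z.1 - z.2) ⬝ᵥ (z.1 - z.2) := by
    simpa [Matrix.sub_mulVec, dotProduct_sub] using hA.dotProduct_mulVec_nonneg (z.1 - z.2)
  have hsum : 0 ≤ (z.1 + z.2) ⬝ᵥ (z.1 + z.2) := dotProduct_self_nonneg _
  have parallelogram : (z.1 - z.2) ⬝ᵥ (z.1 - z.2) + (z.1 + z.2) ⬝ᵥ (z.1 + z.2) =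
      2 * (z.1 ⬝ᵥ z.1 + z.2 ⬝ᵥ z.2) := by
    simp only [sub_dotProduct, dotProduct_sub, add_dotProduct, dotProduct_add]
    ring
  rw [pairForm]
  linarith

end PairForm

section Covariance

variable {ι κ : Type*} [Fintype ι] [Fintype κ]

theorem sum_sum_pairForm (A : Matrix ι ι ℝ) (y : κ → ι → ℝ) :
    ∑ i, ∑ j, pairForm A (y i, y j) =
      Fintype.card κ * ∑ i, y i ⬝ᵥ A *ᵥ y i - (∑ i, y i) ⬝ᵥ A *ᵥ ∑ i, y i := by
  have expand (i j : κ) : pairForm A (y i, y j) = (y i ⬝ᵥ A *ᵥ y i + y j ⬝ᵥ A *ᵥ y j) / 2 -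
      (y i ⬝ᵥ A *ᵥ y j + y j ⬝ᵥ A *ᵥ y i) / 2 := by
    simp only [pairForm, sub_dotProduct, Matrix.mulVec_sub, dotProduct_sub]
    ring
  have cross : ∑ i, ∑ j, y i ⬝ᵥ A *ᵥ y j = (∑ i, y i) ⬝ᵥ A *ᵥ ∑ i, y i := by
    simp only [sum_dotProduct, Matrix.mulVec_sum, dotProduct_sum]
    exact Finset.sum_comm
  have cross' : ∑ i, ∑ j, y j ⬝ᵥ A *ᵥ y i = (∑ i, y i) ⬝ᵥ A *ᵥ ∑ i, y i := by
    rw [Finset.sum_comm, cross]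
  simp only [expand, Finset.sum_sub_distrib, ← Finset.sum_div, Finset.sum_add_distrib, cross,
    cross', Finset.sum_const, Finset.card_univ, nsmul_eq_mul, ← Finset.mul_sum]
  ring

/-- The empirical covariance matrix of a finite sample, normalised by the sample size. -/
noncomputable def empiricalCov (y : κ → ι → ℝ) : Matrix ι ι ℝ :=
  let mean := (1 / (Fintype.card κ : ℝ)) • ∑ i, y i
  (1 / (Fintype.card κ : ℝ)) •
    ∑ i, (Matrix.vecMulVec (y i) (y i) - Matrix.vecMulVec mean mean)

theorem trace_mul_empiricalCov (A : Matrix ι ι ℝ) (y : κ → ι → ℝ) :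
    (A * empiricalCov y).trace =
      (1 - 1 / (Fintype.card κ : ℝ)) * uStat (pairForm A) y := by
  have trace_mul_vecMulVec (v : ι → ℝ) : (A * Matrix.vecMulVec v v).trace = v ⬝ᵥ A *ᵥ v := by
    rw [Matrix.mul_vecMulVec, Matrix.trace_vecMulVec, dotProduct_comm]
  rw [← sum_sum_div_card_sq_eq_uStat (pairForm_self A), sum_sum_pairForm]
  simp only [empiricalCov, Matrix.mul_smul, Matrix.trace_smul, Matrix.mul_sum, Matrix.trace_sum,
    Matrix.mul_sub, Matrix.trace_sub, trace_mul_vecMulVec, Finset.sum_sub_distrib,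
    Finset.sum_const, Finset.card_univ, nsmul_eq_mul, smul_eq_mul, Matrix.mulVec_smul,
    smul_dotProduct, dotProduct_smul]
  rcases eq_or_ne (Fintype.card κ : ℝ) 0 with hn | hn
  · simp [hn]
  · field_simp

theorem covariance_comp_measurePreserving {α γ : Type*} [MeasurableSpace α] [MeasurableSpace γ]
    {ν : Measure α} {ρ : Measure γ} {Z : γ → α} (hZ : MeasurePreserving Z ρ ν) {f g : α → ℝ}
    (hf : AEStronglyMeasurable f ν) (hg : AEStronglyMeasurable g ν) :
    cov[f ∘ Z, g ∘ Z; ρ] = cov[f, g; ν] := by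
  rw [← hZ.map_eq] at hf hg ⊢
  exact (covariance_map hf hg hZ.aemeasurable).symm

theorem integral_sub_mul_sub_prod {α : Type*} [MeasurableSpace α] {ν : Measure α}
    [IsProbabilityMeasure ν] {f g : α → ℝ} (hf : MemLp f 2 ν) (hg : MemLp g 2 ν) :
    ∫ z : α × α, (f z.1 - f z.2) * (g z.1 - g z.2) ∂ν.prod ν = 2 * cov[f, g; ν] := by
  have hf₁ := hf.comp_fst ν
  have hf₂ := hf.comp_snd ν
  have hg₁ := hg.comp_fst ν
  have hg₂ := hg.comp_snd ν
  have hmean : ∫ z : α × α, (f z.1 - f z.2) ∂ν.prod ν = 0 := by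
    rw [integral_sub (hf₁.integrable one_le_two) (hf₂.integrable one_le_two), integral_fun_fst,
      integral_fun_snd, sub_self]
  have hcov₁ : cov[fun z => f z.1, fun z => g z.1; ν.prod ν] = cov[f, g; ν] :=
    covariance_comp_measurePreserving measurePreserving_fst hf.1 hg.1
  have hcov₂ : cov[fun z => f z.2, fun z => g z.2; ν.prod ν] = cov[f, g; ν] :=
    covariance_comp_measurePreserving measurePreserving_snd hf.1 hg.1
  have hcross : cov[fun z => f z.2, fun z => g z.1; ν.prod ν] = 0 := by
    rw [covariance_comm]
    exact covariance_fst_snd_prod hg hf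
  have hprod := covariance_eq_sub (hf₁.sub hf₂) (hg₁.sub hg₂)
  simp only [Pi.mul_apply, Pi.sub_def] at hprod
  calc ∫ z : α × α, (f z.1 - f z.2) * (g z.1 - g z.2) ∂ν.prod ν
      = cov[fun z => f z.1 - f z.2, fun z => g z.1 - g z.2; ν.prod ν] := by
        rw [hprod, hmean, zero_mul, sub_zero]
    _ = 2 * cov[f, g; ν] := by
        rw [covariance_fun_sub_fun_sub hf₁ hf₂ hg₁ hg₂, hcov₁, hcov₂, hcross,
          covariance_fst_snd_prod hf hg]
        ring

/-- The covariance matrix of the coordinates under a law on `ι → ℝ`. -/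
noncomputable def covMatrix (μ : Measure (ι → ℝ)) : Matrix ι ι ℝ :=
  Matrix.of fun a b => cov[fun y => y a, fun y => y b; μ]

variable {μ : Measure (ι → ℝ)} [IsProbabilityMeasure μ]

theorem integral_pairForm (A : Matrix ι ι ℝ) (hμ : ∀ a, MemLp (fun y : ι → ℝ => y a) 2 μ) :
    ∫ z, pairForm A z ∂μ.prod μ = (A * covMatrix μ).trace := by
  have hint (a b : ι) : Integrable (fun z : (ι → ℝ) × (ι → ℝ) =>
      A a b / 2 * ((z.1 a - z.2 a) * (z.1 b - z.2 b))) (μ.prod μ) :=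
    ((((hμ a).comp_fst μ).sub ((hμ a).comp_snd μ)).integrable_mul
      (((hμ b).comp_fst μ).sub ((hμ b).comp_snd μ))).const_mul _
  have expand (z : (ι → ℝ) × (ι → ℝ)) :
      pairForm A z = ∑ a, ∑ b, A a b / 2 * ((z.1 a - z.2 a) * (z.1 b - z.2 b)) := by
    simp only [pairForm, dotProduct, Matrix.mulVec, Finset.mul_sum, Finset.sum_div, Pi.sub_apply]
    exact Finset.sum_congr rfl fun a _ => Finset.sum_congr rfl fun b _ => by ring
  simp only [expand, Matrix.trace, Matrix.diag_apply, Matrix.mul_apply, covMatrix, Matrix.of_apply]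
  rw [integral_finsetSum _ fun a _ => integrable_finsetSum _ fun b _ => hint a b]
  refine Finset.sum_congr rfl fun a _ => ?_
  rw [integral_finsetSum _ fun b _ => hint a b]
  refine Finset.sum_congr rfl fun b _ => ?_
  rw [integral_const_mul, integral_sub_mul_sub_prod (hμ a) (hμ b), covariance_comm]
  ring

end Covariance

section PairMoments

theorem add_rpow_le {x y b : ℝ} (hx : 0 ≤ x) (hy : 0 ≤ y) (hb : 1 ≤ b) :
    (x + y) ^ b ≤ 2 ^ (b - 1) * (x ^ b + y ^ b) := by
  lift x to NNReal using hx
  lift y to NNReal using hy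
  exact_mod_cast NNReal.rpow_add_le_mul_rpow_add_rpow x y hb

variable {α : Type*} {h : α × α → ℝ} {f : α → ℝ} {b : ℝ}

theorem rpow_le_of_le_add (h0 : 0 ≤ h) (hf : 0 ≤ f) (hle : ∀ z, h z ≤ f z.1 + f z.2)
    (hb : 1 ≤ b) (z : α × α) : h z ^ b ≤ 2 ^ (b - 1) * (f z.1 ^ b + f z.2 ^ b) :=
  (Real.rpow_le_rpow (h0 z) (hle z) (by linarith)).trans (add_rpow_le (hf _) (hf _) hb)

variable [MeasurableSpace α] {ν : Measure α} [IsProbabilityMeasure ν]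

theorem integrable_rpow_of_le_add (hh : AEMeasurable h (ν.prod ν)) (h0 : 0 ≤ h) (hf : 0 ≤ f)
    (hle : ∀ z, h z ≤ f z.1 + f z.2) (hb : 1 ≤ b) (hfb : Integrable (fun x => f x ^ b) ν) :
    Integrable (fun z => h z ^ b) (ν.prod ν) := by
  refine (((hfb.comp_fst ν).add (hfb.comp_snd ν)).const_mul (2 ^ (b - 1))).mono'
    (hh.pow_const b).aestronglyMeasurable (ae_of_all _ fun z => ?_)
  rw [Real.norm_of_nonneg (Real.rpow_nonneg (h0 z) b)]
  exact rpow_le_of_le_add h0 hf hle hb z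

theorem integral_rpow_le_of_le_add (h0 : 0 ≤ h) (hf : 0 ≤ f)
    (hle : ∀ z, h z ≤ f z.1 + f z.2) (hb : 1 ≤ b) (hfb : Integrable (fun x => f x ^ b) ν) :
    ∫ z, h z ^ b ∂ν.prod ν ≤ 2 ^ b * ∫ x, f x ^ b ∂ν := by
  have hfst := hfb.comp_fst ν
  have hsnd := hfb.comp_snd ν
  calc ∫ z, h z ^ b ∂ν.prod ν
      ≤ ∫ z : α × α, 2 ^ (b - 1) * (f z.1 ^ b + f z.2 ^ b) ∂ν.prod ν :=
        integral_mono_of_nonneg (ae_of_all _ fun z => Real.rpow_nonneg (h0 z) b)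
          ((hfst.add hsnd).const_mul _) (ae_of_all _ (rpow_le_of_le_add h0 hf hle hb))
    _ = 2 ^ (b - 1) * (2 * ∫ x, f x ^ b ∂ν) := by
        rw [integral_const_mul, integral_add hfst hsnd, integral_fun_fst fun x => f x ^ b,
          integral_fun_snd fun x => f x ^ b, probReal_univ, one_smul, two_mul]
    _ = 2 ^ b * ∫ x, f x ^ b ∂ν := by
        rw [← mul_assoc, ← Real.rpow_add_one two_ne_zero, sub_add_cancel]

end PairMoments

section CovarianceDeviation

variable {ι κ Ω : Type*} [Fintype ι] [Fintype κ] {μ : Measure (ι → ℝ)} {b : ℝ}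

theorem measurable_dotProduct_self : Measurable fun y : ι → ℝ => y ⬝ᵥ y := by
  unfold dotProduct
  fun_prop

theorem memLp_two_apply [IsProbabilityMeasure μ] (hb : 1 ≤ b)
    (hmom : Integrable (fun y => (y ⬝ᵥ y) ^ b) μ) (a : ι) : MemLp (fun y => y a) 2 μ := by
  have hint : Integrable (fun y : ι → ℝ => y ⬝ᵥ y) μ := by
    simpa using integrable_rpow_of_le measurable_dotProduct_self.aestronglyMeasurable
      dotProduct_self_nonneg zero_le_one hb hmom
  rw [memLp_two_iff_integrable_sq (measurable_pi_apply a).aestronglyMeasurable]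
  refine hint.mono' ((measurable_pi_apply a).pow_const 2).aestronglyMeasurable
    (ae_of_all _ fun y => ?_)
  rw [Real.norm_of_nonneg (sq_nonneg _), sq]
  exact Finset.single_le_sum (f := fun i => y i * y i) (fun _ _ => mul_self_nonneg _)
    (Finset.mem_univ a)

/-- The constant in the deviation bound for empirical covariances under a moment of order `b` of
the squared norm. The factor `8 ^ b` collects a factor `2` from bounding the kernel by the squared
norms of its two arguments and a factor `4` from halving the deviation twice. -/
noncomputable def deviationConst (b : ℝ) : ℝ := (4 * tailOrder b) ^ tailOrder b * 8 ^ b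

theorem deviationConst_pos (hb : 1 < b) : 0 < deviationConst b := by
  have := tailOrder_pos hb
  rw [deviationConst]
  positivity

theorem le_sub_half_of_one_sub_inv_mul_le {n α τ U : ℝ} (hα : 0 < α) (hα₁ : α ≤ 1)
    (hn : 2 / α ≤ n) (hτ : 0 ≤ τ) (hU : (1 - 1 / n) * U ≤ (1 - α) * τ) :
    U ≤ τ - α / 2 * τ := by
  have : 2 ≤ n := ((le_div_iff₀ hα).2 (by linarith)).trans hn
  have hinv : 1 / n ≤ α / 2 := by
    simpa using one_div_le_one_div_of_le (by positivity) hn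
  have hfactor : 0 < 1 - 1 / n := by linarith
  refine le_of_mul_le_mul_left (hU.trans ?_) hfactor
  have hmul : 1 - α ≤ (1 - α / 2) * (1 - 1 / n) := by nlinarith
  nlinarith

theorem half_mul_half_rpow_neg {α τ : ℝ} (hα : 0 < α) (hτ : 0 < τ) (b : ℝ) :
    (α / 2 * τ / 2) ^ (-b) = 4 ^ b * (1 / α ^ b) * τ ^ (-b) := by
  rw [show α / 2 * τ / 2 = 4⁻¹ * α * τ by ring, Real.mul_rpow (by positivity) hτ.le,
    Real.mul_rpow (by norm_num) hα.le, Real.rpow_neg (by norm_num), Real.inv_rpow (by norm_num),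
    inv_inv, Real.rpow_neg hα.le, one_div]

variable [MeasurableSpace Ω] {Q : Measure Ω} [IsProbabilityMeasure Q] [IsProbabilityMeasure μ]
  {Y : κ → Ω → ι → ℝ} {A : Matrix ι ι ℝ}

theorem measureReal_trace_empiricalCov_le [DecidableEq ι] (hY : iIndepFun Y Q)
    (hm : ∀ i, AEMeasurable (Y i) Q) (hlaw : ∀ i, Q.map (Y i) = μ) (hA : A.PosSemidef)
    (hA' : (1 - A).PosSemidef) (hb : 1 < b) (hmom : Integrable (fun y => (y ⬝ᵥ y) ^ b) μ)
    (hτ : 0 < (A * covMatrix μ).trace) {α : ℝ} (hα : 0 < α) (hα₁ : α ≤ 1)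
    (hcard : 2 / α ≤ Fintype.card κ) :
    Q.real {ω | (A * empiricalCov fun i => Y i ω).trace ≤ (1 - α) * (A * covMatrix μ).trace} ≤
      deviationConst b * (Fintype.card κ : ℝ) ^ (-tailOrder b) * (1 / α ^ b) *
        (∫ y, (y ⬝ᵥ y) ^ b ∂μ) * (A * covMatrix μ).trace ^ (-b) := by
  have hmean := integral_pairForm A (memLp_two_apply hb.le hmom)
  set τ := (A * covMatrix μ).trace
  have hint := integrable_rpow_of_le_add (measurable_pairForm A).aemeasurable
    (pairForm_nonneg hA) dotProduct_self_nonneg (pairForm_le hA') hb.le hmom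
  have hmoment := integral_rpow_le_of_le_add (pairForm_nonneg hA) dotProduct_self_nonneg
    (pairForm_le hA') hb.le hmom
  have hcard₂ : 2 ≤ Fintype.card κ := by
    exact_mod_cast ((le_div_iff₀ hα).2 (by linarith) : 2 ≤ 2 / α).trans hcard
  have := tailOrder_pos hb
  calc Q.real {ω | (A * empiricalCov fun i => Y i ω).trace ≤ (1 - α) * τ}
      ≤ Q.real {ω | uStat (pairForm A) (fun i => Y i ω) ≤
          ∫ z, pairForm A z ∂μ.prod μ - α / 2 * τ} := by
        refine measureReal_mono fun ω hω => ?_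
        rw [Set.mem_ofPred_eq, trace_mul_empiricalCov] at hω
        rw [Set.mem_ofPred_eq, hmean]
        exact le_sub_half_of_one_sub_inv_mul_le hα hα₁ hcard hτ.le hω
    _ ≤ (4 * tailOrder b) ^ tailOrder b * (Fintype.card κ : ℝ) ^ (-tailOrder b) *
          ((α / 2 * τ / 2) ^ (-b) * ∫ z, pairForm A z ^ b ∂μ.prod μ) :=
        measureReal_uStat_le_rpow hY hm hlaw hcard₂ (measurable_pairForm A) (pairForm_nonneg hA)
          hb hint (hmean ▸ hτ) (by positivity)
    _ ≤ (4 * tailOrder b) ^ tailOrder b * (Fintype.card κ : ℝ) ^ (-tailOrder b) *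
          (4 ^ b * (1 / α ^ b) * τ ^ (-b) * (2 ^ b * ∫ y, (y ⬝ᵥ y) ^ b ∂μ)) := by
        rw [half_mul_half_rpow_neg hα hτ]
        gcongr
    _ = _ := by
        have hconst : (8 : ℝ) ^ b = 4 ^ b * 2 ^ b := by
          rw [← Real.mul_rpow (by norm_num) (by norm_num)]
          norm_num
        rw [deviationConst, hconst]
        ring

end CovarianceDeviation

section Observations

variable {T Ω : Type*} [MeasurableSpace Ω] {p : ℕ} {P : Measure Ω} {X : T → Ω → ℝ} {β : ℝ}

theorem measurable_obsVec (t : Fin p → T) : Measurable (obsVec t) :=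
  measurable_pi_lambda _ fun a =>
    (measurable_pi_apply (t a.2)).mul (measurable_pi_apply (t a.1))

theorem frob_obsSq_rpow (t : Fin p → T) (path : T → ℝ) (β : ℝ) :
    frob (obsSq t path) ^ β = (obsVec t path ⬝ᵥ obsVec t path) ^ (β / 2) := by
  rw [frob, Matrix.trace_mul_comm, ← Matrix.vec_dotProduct_vec]
  change Real.sqrt (obsVec t path ⬝ᵥ obsVec t path) ^ β = _
  rw [Real.sqrt_eq_rpow, ← Real.rpow_mul (dotProduct_self_nonneg _), one_div_mul_eq_div]

theorem normMoment_nonneg (t : Fin p → T) (X : T → Ω → ℝ) (P : Measure Ω) (β : ℝ) :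
    0 ≤ normMoment t X P β :=
  integral_nonneg fun _ => Real.rpow_nonneg (Real.sqrt_nonneg _) _

variable (t : Fin p → T) (hX : AEMeasurable (fun ω s => X s ω) P)
include hX

theorem aemeasurable_obsVec : AEMeasurable (fun ω => obsVec t fun s => X s ω) P :=
  (measurable_obsVec t).comp_aemeasurable hX

theorem phiMat_eq_covMatrix :
    phiMat t X P = covMatrix (P.map fun ω => obsVec t fun s => X s ω) := by
  ext a b
  rw [phiMat, covMatrix, Matrix.of_apply, Matrix.of_apply,
    covariance_map_fun (measurable_pi_apply a).aestronglyMeasurable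
      (measurable_pi_apply b).aestronglyMeasurable (aemeasurable_obsVec t hX)]

theorem normMoment_eq_integral_map (β : ℝ) :
    normMoment t X P β = ∫ y, (y ⬝ᵥ y) ^ (β / 2) ∂P.map fun ω => obsVec t fun s => X s ω := by
  rw [integral_map (aemeasurable_obsVec t hX)
    (measurable_dotProduct_self.pow_const _).aestronglyMeasurable]
  simp only [normMoment, frob_obsSq_rpow]

theorem integrable_map_obsVec
    (hmom : Integrable (fun ω => frob (obsSq t fun s => X s ω) ^ β) P) :
    Integrable (fun y => (y ⬝ᵥ y) ^ (β / 2)) (P.map fun ω => obsVec t fun s => X s ω) := by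
  rw [integrable_map_measure (measurable_dotProduct_self.pow_const _).aestronglyMeasurable
    (aemeasurable_obsVec t hX)]
  simpa only [frob_obsSq_rpow, Function.comp_def] using hmom

end Observations

section Deviation

variable {T Λ Ω₀ : Type*} [MeasurableSpace Ω₀] {P : Measure Ω₀} {p n : ℕ} {t : Fin p → T}
  {X : T → Ω₀ → ℝ} {g : Λ → T → ℝ} {m : Finset Λ} {α β κ : ℝ}

theorem phiHat_eq_empiricalCov (t : Fin p → T) (paths : Fin n → T → ℝ) :
    phiHat t paths = empiricalCov fun i => obsVec t (paths i) := by
  simp only [phiHat, meanVec, empiricalCov, Fintype.card_fin]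

theorem deltaHatSq_le_mul_deltaSq_iff (hD : 0 < dimM g t m) (paths : Fin n → T → ℝ) (c : ℝ) :
    deltaHatSq g t paths m ≤ c * deltaSq g t X P m ↔
      projTrace g t (phiHat t paths) m ≤ c * projTrace g t (phiMat t X P) m := by
  rw [deltaHatSq, deltaSq, ← mul_div_assoc, div_le_div_iff_of_pos_right hD]

theorem delta_rpow_neg_mul_dimM_rpow_neg (hD : 0 < dimM g t m)
    (hτ : 0 ≤ projTrace g t (phiMat t X P) m) (β : ℝ) :
    delta g t X P m ^ (-β) * dimM g t m ^ (-(β / 2)) =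
      projTrace g t (phiMat t X P) m ^ (-(β / 2)) := by
  have hδ : 0 ≤ deltaSq g t X P m := div_nonneg hτ hD.le
  rw [delta, Real.sqrt_eq_rpow, ← Real.rpow_mul hδ, show 1 / 2 * -β = -(β / 2) by ring,
    ← Real.mul_rpow hδ hD.le, deltaSq, div_mul_cancel₀ _ hD.ne']

theorem projTrace_pos_of_cInf_pos {M : Finset (Finset Λ)} (h : 0 < cInf g t X P M) (hm : m ∈ M) :
    0 < projTrace g t (phiMat t X P) m :=
  h.trans_le (ciInf_le (Set.finite_range _).bddBelow (⟨m, hm⟩ : M))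

theorem div_four_le_tailOrder (hκ : κ ≤ min β (2 * β - 4)) : κ / 4 ≤ tailOrder (β / 2) := by
  obtain ⟨hκ₁, hκ₂⟩ := le_min_iff.1 hκ
  exact le_min (by linarith) (by linarith)

theorem div_one_sub_le_div_four {q : ℝ} (hq : 0 < q) (hq₁ : q ≤ 1)
    (hκ : 2 * (1 + 2 * q) < κ) : q / (1 - 2 * q / κ) ≤ κ / 4 := by
  have hκ₀ : 0 < κ := by linarith
  have hden : 1 - 2 * q / κ = (κ - 2 * q) / κ := by field_simp
  rw [hden, div_div_eq_mul_div, div_le_iff₀ (by linarith)]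
  nlinarith

theorem measureReal_compl_biInter_le {ι Ω : Type*} [MeasurableSpace Ω] {Q : Measure Ω}
    [IsFiniteMeasure Q] (M : Finset ι) (f h : ι → Ω → ℝ) :
    Q.real (⋂ m ∈ M, {ω | f m ω ≤ h m ω})ᶜ ≤ ∑ m ∈ M, Q.real {ω | h m ω ≤ f m ω} := by
  refine (measureReal_mono ?_ (measure_ne_top _ _)).trans
    (measureReal_biUnion_finset_le M fun m => {ω | h m ω ≤ f m ω})
  simp only [Set.compl_iInter]
  exact Set.iUnion₂_mono fun m _ ω (hω : ¬f m ω ≤ h m ω) => (not_le.1 hω).le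

variable {Ω : Type*} [MeasurableSpace Ω] {Q : Measure Ω} [IsProbabilityMeasure Q]
  {Xs : Fin n → T → Ω → ℝ}

theorem measureReal_deltaHatSq_le_tailOrder (hβ : 2 < β) (hα : α ∈ Set.Ioc 0 1)
    (hmom : Integrable (fun ω => frob (obsSq t fun s => X s ω) ^ β) P) (hD : 0 < dimM g t m)
    (hτ : 0 < projTrace g t (phiMat t X P) m) (hn : 2 / α ≤ n)
    (hind : iIndepFun (fun i ω s => Xs i s ω) Q)
    (hid : ∀ i, IdentDistrib (fun ω s => Xs i s ω) (fun ω s => X s ω) Q P) :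
    Q.real {ω | deltaHatSq g t (fun i s => Xs i s ω) m ≤ (1 - α) * deltaSq g t X P m} ≤
      deviationConst (β / 2) * (n : ℝ) ^ (-tailOrder (β / 2)) * (1 / α ^ (β / 2)) *
        normMoment t X P β * (delta g t X P m ^ (-β) * dimM g t m ^ (-(β / 2))) := by
  have hlaw (i : Fin n) : IdentDistrib (fun ω => obsVec t fun s => Xs i s ω)
      (fun ω => obsVec t fun s => X s ω) Q P := (hid i).comp (measurable_obsVec t)
  have hn₀ : (0 : ℝ) < n := (div_pos two_pos hα.1).trans_le hn
  let i₀ : Fin n := ⟨0, by exact_mod_cast hn₀⟩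
  have hX := (hid i₀).aemeasurable_snd
  have hμ : IsProbabilityMeasure (P.map fun ω => obsVec t fun s => X s ω) :=
    (hlaw i₀).map_eq ▸ Measure.isProbabilityMeasure_map (hlaw i₀).aemeasurable_fst
  have hproj := isStarProjection_kronecker (isStarProjection_proj g t m)
    (isStarProjection_proj g t m)
  have hY : iIndepFun (fun i ω => obsVec t fun s => Xs i s ω) Q :=
    hind.comp (fun _ => obsVec t) fun _ => measurable_obsVec t
  rw [delta_rpow_neg_mul_dimM_rpow_neg hD hτ.le, normMoment_eq_integral_map t hX]
  simp only [deltaHatSq_le_mul_deltaSq_iff hD, projTrace, phiHat_eq_empiricalCov,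
    phiMat_eq_covMatrix t hX] at hτ ⊢
  simpa only [Fintype.card_fin] using measureReal_trace_empiricalCov_le hY
    (fun i => (hlaw i).aemeasurable_fst) (fun i => (hlaw i).map_eq)
    (posSemidef_of_isStarProjection hproj) (posSemidef_of_isStarProjection hproj.one_sub)
    (by linarith) (integrable_map_obsVec t hX hmom) hτ hα.1 hα.2 (by simpa using hn)

theorem measureReal_deltaHatSq_le (hβ : 2 < β) (hκ : κ ≤ min β (2 * β - 4))
    (hα : α ∈ Set.Ioc 0 1) (hmom : Integrable (fun ω => frob (obsSq t fun s => X s ω) ^ β) P)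
    (hD : 0 < dimM g t m) (hτ : 0 < projTrace g t (phiMat t X P) m) (hn : 2 / α ≤ n)
    (hind : iIndepFun (fun i ω s => Xs i s ω) Q)
    (hid : ∀ i, IdentDistrib (fun ω s => Xs i s ω) (fun ω s => X s ω) Q P)
    {c₁ c₂ : ℝ} (hc₁ : deviationConst (β / 2) ≤ c₁) (hc₂ : 0 ≤ c₂) :
    Q.real {ω | deltaHatSq g t (fun i s => Xs i s ω) m ≤ (1 - α) * deltaSq g t X P m} ≤
      (n : ℝ) ^ (-(κ / 4)) * (c₂ + c₁ * (1 / α ^ (β / 2))) * normMoment t X P β *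
        delta g t X P m ^ (-β) * dimM g t m ^ (-(β / 2)) := by
  have hα₀ : 0 < α := hα.1
  have hn₁ : (1 : ℝ) ≤ n := by
    linarith [(le_div_iff₀ hα₀).2 (by linarith [hα.2] : 2 * α ≤ 2)]
  have hc₁₀ : 0 < c₁ := (deviationConst_pos (by linarith)).trans_le hc₁
  have hord := div_four_le_tailOrder hκ
  have hN := normMoment_nonneg t X P β
  have hδ : 0 ≤ delta g t X P m ^ (-β) := Real.rpow_nonneg (Real.sqrt_nonneg _) _
  calc Q.real {ω | deltaHatSq g t (fun i s => Xs i s ω) m ≤ (1 - α) * deltaSq g t X P m}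
      ≤ deviationConst (β / 2) * (n : ℝ) ^ (-tailOrder (β / 2)) * (1 / α ^ (β / 2)) *
          normMoment t X P β * (delta g t X P m ^ (-β) * dimM g t m ^ (-(β / 2))) :=
        measureReal_deltaHatSq_le_tailOrder hβ hα hmom hD hτ hn hind hid
    _ ≤ c₁ * (n : ℝ) ^ (-(κ / 4)) * (1 / α ^ (β / 2)) * normMoment t X P β *
          (delta g t X P m ^ (-β) * dimM g t m ^ (-(β / 2))) := by
        gcongr
    _ = (n : ℝ) ^ (-(κ / 4)) * (c₁ * (1 / α ^ (β / 2))) * normMoment t X P β *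
          delta g t X P m ^ (-β) * dimM g t m ^ (-(β / 2)) := by ring
    _ ≤ _ := by
        gcongr
        exact le_add_of_nonneg_left hc₂

end Deviation

end CovSel

theorem mainTheorem3_general :
    ∃ (C₁ C₂ : ℝ → ℝ) (n₀ : ℝ → ℕ), (∀ β, 0 < C₁ β ∧ 0 < C₂ β) ∧
    ∀ (β κ α : ℝ), 2 < β → κ ≤ min β (2 * β - 4) → α ∈ Set.Ioc (0 : ℝ) 1 →
    ∀ (T : Type*) (p : ℕ) (t : Fin p → T) (Ω₀ : Type*) [MeasurableSpace Ω₀] (P : Measure Ω₀)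
      (X : T → Ω₀ → ℝ), Integrable (fun ω => frob (obsSq t (fun s => X s ω)) ^ β) P →
    ∀ (Λ : Type*) (g : Λ → T → ℝ) (M : Finset (Finset Λ)), (∀ m ∈ M, 0 < dimM g t m) →
      (∀ m ∈ M, 0 < projTrace g t (phiMat t X P) m) →
    ∀ (n : ℕ), n₀ α ≤ n →
    ∀ (Ω : Type*) [MeasurableSpace Ω] (Q : Measure Ω) [IsProbabilityMeasure Q]
      (Xs : Fin n → T → Ω → ℝ), iIndepFun (fun i ω s => Xs i s ω) Q →
      (∀ i, IdentDistrib (fun ω s => Xs i s ω) (fun ω s => X s ω) Q P) →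
      (∀ m ∈ M,
        Q.real {ω | deltaHatSq g t (fun i s => Xs i s ω) m ≤ (1 - α) * deltaSq g t X P m} ≤
          (n : ℝ) ^ (-(κ / 4)) *
            (C₂ β * 2 ^ (β + 1) + C₁ β * (1 / α ^ (β / 2))) * normMoment t X P β *
            delta g t X P m ^ (-β) * dimM g t m ^ (-(β / 2))) ∧
      Q.real (⋂ m ∈ M,
          {ω | (1 - α) * deltaSq g t X P m ≤ deltaHatSq g t (fun i s => Xs i s ω) m})ᶜ ≤
        ((C₂ β * 2 ^ (β + 1) + C₁ β * (1 / α ^ (β / 2))) * normMoment t X P β *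
            ∑ m ∈ M, delta g t X P m ^ (-β) * dimM g t m ^ (-(β / 2))) *
          (n : ℝ) ^ (-(κ / 4)) := by
  refine ⟨fun β => max 1 (deviationConst (β / 2)), fun _ => 1, fun α => ⌈2 / α⌉₊,
    fun β => ⟨one_pos.trans_le (le_max_left _ _), one_pos⟩, ?_⟩
  intro β κ α hβ hκ hα T p t Ω₀ _ P X hmom Λ g M hD hτ n hn Ω _ Q _ Xs hind hid
  have hdev := fun m hm => measureReal_deltaHatSq_le hβ hκ hα hmom (hD m hm) (hτ m hm)
    (Nat.ceil_le.1 hn) hind hid (le_max_right 1 _)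
    (by positivity : (0 : ℝ) ≤ 1 * 2 ^ (β + 1))
  refine ⟨hdev, ?_⟩
  refine (measureReal_compl_biInter_le _ _ _).trans ((Finset.sum_le_sum hdev).trans_eq ?_)
  rw [Finset.mul_sum, Finset.sum_mul]
  exact Finset.sum_congr rfl fun m _ => by ring

theorem mainTheorem3 :
    -- the constants depend on `β` only, the threshold on `κ, β, α, C_inf, Σ` only
    ∃ (C₁ C₂ : ℝ → ℝ)
      (n₀ : (κ β α Cinf : ℝ) → (p : ℕ) → (Sig : Matrix (Fin p) (Fin p) ℝ) → ℕ),
    (∀ β, 0 < C₁ β ∧ 0 < C₂ β) ∧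
    ∀ (q β κ α : ℝ), 0 < q → q ≤ 1 →
      max (2 * (1 + 2 * q)) (3 + 2 * q) < β →
      κ ∈ Set.Ioo (2 * (1 + 2 * q)) (min β (2 * β - 4)) →
      α ∈ Set.Ioo (0 : ℝ) 1 →
    -- the centred second-order process `X`, observed at `t_1, …, t_p`
    ∀ (d : ℕ) (T : Set (EuclideanSpace ℝ (Fin d))) (p : ℕ) (t : Fin p → T)
      (Ω₀ : Type*) [MeasurableSpace Ω₀] (P : Measure Ω₀) [IsProbabilityMeasure P]
      (X : T → Ω₀ → ℝ),
      (∀ s, Measurable (X s)) → (∀ s, MemLp (X s) 2 P) → (∀ s, ∫ ω, X s ω ∂P = 0) →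
      Integrable (fun ω => frob (obsSq t (fun s => X s ω)) ^ β) P →
    -- the finite collection of models
    ∀ (Λ : Type*) [Countable Λ] (g : Λ → T → ℝ) (M : Finset (Finset Λ)),
      (∀ m ∈ M, 0 < dimM g t m) → 0 < cInf g t X P M →
    -- the sample of `n` independent copies of `X`
    ∀ (n : ℕ), n₀ κ β α (cInf g t X P M) p (sigmaMat t X P) ≤ n →
    ∀ (Ω : Type*) [MeasurableSpace Ω] (Q : Measure Ω) [IsProbabilityMeasure Q]
      (Xs : Fin n → T → Ω → ℝ),
      iIndepFun (fun i ω s => Xs i s ω) Q →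
      (∀ i, IdentDistrib (fun ω s => Xs i s ω) (fun ω s => X s ω) Q P) →
      q / (1 - 2 * q / κ) ≤ κ / 4 ∧
      (∀ m ∈ M,
        Q.real {ω | deltaHatSq g t (fun i s => Xs i s ω) m ≤ (1 - α) * deltaSq g t X P m} ≤
          (n : ℝ) ^ (-(κ / 4)) *
            (C₂ β * 2 ^ (β + 1) + C₁ β * (1 / α ^ (β / 2))) * normMoment t X P β *
            delta g t X P m ^ (-β) * dimM g t m ^ (-(β / 2))) ∧
      Q.real (⋂ m ∈ M,
          {ω | (1 - α) * deltaSq g t X P m ≤ deltaHatSq g t (fun i s => Xs i s ω) m})ᶜ ≤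
        ((C₂ β * 2 ^ (β + 1) + C₁ β * (1 / α ^ (β / 2))) * normMoment t X P β *
            ∑ m ∈ M, delta g t X P m ^ (-β) * dimM g t m ^ (-(β / 2))) *
          (n : ℝ) ^ (-(κ / 4)) := by
  obtain ⟨C₁, C₂, n₀, hC, hbound⟩ := mainTheorem3_general
  refine ⟨C₁, C₂, fun _ _ α _ _ _ => n₀ α, hC, ?_⟩
  intro q β κ α hq hq₁ hβ hκ hα d T p t Ω₀ _ P _ X _ _ _ hmom Λ _ g M hD hCinf n hn Ω _ Q _ Xs
    hind hid
  exact ⟨div_one_sub_le_div_four hq hq₁ hκ.1,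
    hbound β κ α (by linarith [(max_lt_iff.1 hβ).1]) hκ.2.le (Set.Ioo_subset_Ioc_self hα) T p t
      Ω₀ P X hmom Λ g M hD (fun m hm => projTrace_pos_of_cInf_pos hCinf hm) n hn Ω Q Xs hind hid⟩
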